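/- Let $\Gamma$ be a quotient of $\mathbb{Z}^d$, that is, an abelian group with a surjective homomorphism $\pi:\mathbb{Z}^d\to\Gamma$. For finite subsets $F_1,\dots,F_k$ of an abelian group $G$, let $\mathrm{Tile}(F_1,\dots,F_k;G)$ be the set of all $k$-tuples $(A_1,\dots,A_k)$ of subsets of $G$ for which every $g\in G$ can be written as $g=f+a$ with $f\in F_j$ and $a\in A_j$ for exactly one triple $(j,f,a)$; equivalently, $G=\biguplus_{j=1}^k (F_j\oplus A_j)$. Tiling by $k$ tiles in $G$ is called algorithmically decidable if there is an algorithm which halts on every input $(F_1,\dots,F_k)$ of finite subsets of $G$ and decides whether $\mathrm{Tile}(F_1,\dots,F_k;G)\neq\emptyset$. Here finite sets are given as lists of elements; elements of $\mathbb{Z}^d$ are given by their coordinates, and elements of $\Gamma$ are given as integer combinations of a fixed finite generating tuple of $\Gamma$, i.e. by vectors $v\in\mathbb{Z}^n$ representing $p(v)$ for a fixed surjective homomorphism $p:\mathbb{Z}^n\to\Gamma$. For every $k\in\mathbb{N}$, if tiling by $k$ tiles in $\mathbb{Z}^d$ is algorithmically decidable, then tiling by $k$ tiles in $\Gamma$ is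 algorithmically decidable, for every choice of the finite generating tuple used to describe the elements of $\Gamma$ (for instance, for $n=d$ and $p=\pi$). -/

import Mathlib

open scoped Pointwise

namespace TranslationalTiling

/-- `A ⊕ B = C`: the sumset of `A` and `B` is `C`, and every `c ∈ C` can be written as `c = a + b`
with `a ∈ A` and `b ∈ B` for a unique pair `(a, b)`. -/
def IsDirectSum {G : Type*} [AddCommGroup G] (A B C : Set G) : Prop :=
  A + B = C ∧ ∀ c ∈ C, ∃! p : G × G, p.1 ∈ A ∧ p.2 ∈ B ∧ p.1 + p.2 = c

/-- `Tile(F₁, …, F_k; E)`: the set of all `k`-tuples `(A₁, …, A_k)` of subsets of `G` such that each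
sum `F_j ⊕ A_j` is direct, and `E` is the disjoint union of the sets `F_j ⊕ A_j`. -/
def Tile {G : Type*} [AddCommGroup G] {k : ℕ} (F : Fin k → Set G) (E : Set G) :
    Set (Fin k → Set G) :=
  {A | (∀ j, IsDirectSum (F j) (A j) (F j + A j)) ∧
    (∀ i j, i ≠ j → Disjoint (F i + A i) (F j + A j)) ∧
    ⋃ j, (F j + A j) = E}

/-- Let `G` be a group with generators `p e₁, …, p eₙ`, where `p : ℤⁿ → G` is a surjective
homomorphism. An element of `G` is given as input by an integer vector that `p` maps to it, and a
finite subset of `G` by a finite list of such vectors. Tiling of `G` by `k` tiles is algorithmically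
decidable if there is a (total) algorithm which, given any finite subsets `F₁, …, F_k` of `G`,
decides whether `Tile(F₁, …, F_k; G)` is nonempty. -/
def TilingDecidable {G : Type*} [AddCommGroup G] {n : ℕ} (p : (Fin n → ℤ) →+ G) (k : ℕ) : Prop :=
  ComputablePred fun F : Fin k → List (Fin n → ℤ) =>
    (Tile (fun j => p '' {v | v ∈ F j}) (Set.univ : Set G)).Nonempty

end TranslationalTiling

namespace TranslationalTiling

/-! The proof is a many-one reduction from tiling `Γ` to tiling `ℤᵈ` with the same number of tiles.
By Smith normal form, `Γ` is `ℤᵈ` modulo vectors `l i = m i • eᵢ` (`exists_surjective_ker_eq_dvd`).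
The task is to lift the tiles to `ℤᵈ` so that every tiling by the lifts descends to the quotient.

Dilate coordinate `0` by a large `N` (the map `D`), and replace each point of a tile by a cell of
`N` consecutive points. In one cell of each tile, cut `d` holes and move the points of the `i`-th
hole by `D (l i)`. Modulo `D (ker σ)` nothing has changed, so a tiling of `Γ` pulls back
(`covers_liftTile`).

Conversely, all hole lengths, over all tiles and all `i`, are distinct and lie between `M` and `2M`,
and the intact stretches have length at least `2M`. An intact stretch is thus too long for a hole,
and two pieces do not fit in one. So a hole is filled by its own moved piece, from a translate of
the same tile by `a - D (l i)` (`sub_mem_of_covers`). Each translation set is therefore closed under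
subtracting every `D (l i)`, which suffices to descend to `Γ` (`exists_covers_of_covers_liftTile`).

The lift is computed from finitely many fixed integers, hence is primitive recursive
(`primrec_liftList`). -/

/-! ### Primitive recursive integer arithmetic -/

theorem encode_int_of_nonneg (m : ℕ) : Encodable.encode (m : ℤ) = 2 * m := rfl

theorem encode_int_negSucc (m : ℕ) : Encodable.encode (Int.negSucc m) = 2 * m + 1 := rfl

/-- The parity of the code of an integer is its sign. Positive and negative parts then reduce
integer arithmetic to that of natural numbers. -/
theorem primrec_int_toNat : Primrec Int.toNat := by
  have h : Primrec fun z : ℤ =>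
      if Encodable.encode z % 2 = 0 then Encodable.encode z / 2 else 0 :=
    Primrec.ite (Primrec.eq.comp (Primrec.nat_mod.comp Primrec.encode (Primrec.const 2))
      (Primrec.const 0)) (Primrec.nat_div.comp Primrec.encode (Primrec.const 2)) (Primrec.const 0)
  refine h.of_eq fun z => ?_
  cases z with
  | ofNat m =>
    have := encode_int_of_nonneg m
    simp only [Int.ofNat_eq_natCast] at this ⊢
    rw [this]; simp
  | negSucc m => rw [encode_int_negSucc, if_neg (by omega)]; rfl

theorem primrec_int_neg_toNat : Primrec fun z : ℤ => (-z).toNat := by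
  have h : Primrec fun z : ℤ =>
      if Encodable.encode z % 2 = 0 then 0 else Encodable.encode z / 2 + 1 :=
    Primrec.ite (Primrec.eq.comp (Primrec.nat_mod.comp Primrec.encode (Primrec.const 2))
      (Primrec.const 0)) (Primrec.const 0)
      (Primrec.succ.comp (Primrec.nat_div.comp Primrec.encode (Primrec.const 2)))
  refine h.of_eq fun z => ?_
  cases z with
  | ofNat m =>
    have := encode_int_of_nonneg m
    simp only [Int.ofNat_eq_natCast] at this ⊢
    rw [this]; simp
  | negSucc m => rw [encode_int_negSucc, if_neg (by omega)]; omega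

/-- Subtraction of natural numbers, with values in `ℤ`, is primitive recursive. -/
theorem primrec_natCast_sub : Primrec₂ fun a b : ℕ => (a : ℤ) - b := by
  have h : Primrec₂ fun a b : ℕ => if b ≤ a then 2 * (a - b) else 2 * (b - a) - 1 :=
    Primrec.ite (Primrec.nat_le.comp Primrec.snd Primrec.fst)
      (Primrec.nat_mul.comp (Primrec.const 2) (Primrec.nat_sub.comp Primrec.fst Primrec.snd))
      (Primrec.nat_sub.comp
        (Primrec.nat_mul.comp (Primrec.const 2) (Primrec.nat_sub.comp Primrec.snd Primrec.fst))
        (Primrec.const 1))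
  refine Primrec.encode_iff.1 (Primrec.of_eq h fun ⟨a, b⟩ => ?_)
  dsimp only
  split_ifs with hab
  · rw [show (a : ℤ) - b = ((a - b : ℕ) : ℤ) by omega, encode_int_of_nonneg]
  · rw [show (a : ℤ) - b = Int.negSucc (b - a - 1) by omega, encode_int_negSucc]; omega

theorem primrec_int_add : Primrec₂ fun z w : ℤ => z + w := by
  have h : Primrec₂ fun z w : ℤ =>
      ((z.toNat + w.toNat : ℕ) : ℤ) - ((-z).toNat + (-w).toNat : ℕ) :=
    primrec_natCast_sub.comp
      (Primrec.nat_add.comp (primrec_int_toNat.comp Primrec.fst) (primrec_int_toNat.comp Primrec.snd))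
      (Primrec.nat_add.comp (primrec_int_neg_toNat.comp Primrec.fst)
        (primrec_int_neg_toNat.comp Primrec.snd))
  exact h.of_eq fun z w => by omega

theorem primrec_int_mul : Primrec₂ fun z w : ℤ => z * w := by
  have h : Primrec₂ fun z w : ℤ =>
      ((z.toNat * w.toNat + (-z).toNat * (-w).toNat : ℕ) : ℤ)
        - (z.toNat * (-w).toNat + (-z).toNat * w.toNat : ℕ) := by
    have p1 := primrec_int_toNat.comp (Primrec.fst (α := ℤ) (β := ℤ))
    have p2 := primrec_int_toNat.comp (Primrec.snd (α := ℤ) (β := ℤ))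
    have n1 := primrec_int_neg_toNat.comp (Primrec.fst (α := ℤ) (β := ℤ))
    have n2 := primrec_int_neg_toNat.comp (Primrec.snd (α := ℤ) (β := ℤ))
    exact primrec_natCast_sub.comp
      (Primrec.nat_add.comp (Primrec.nat_mul.comp p1 p2) (Primrec.nat_mul.comp n1 n2))
      (Primrec.nat_add.comp (Primrec.nat_mul.comp p1 n2) (Primrec.nat_mul.comp n1 p2))
  refine h.of_eq fun z w => ?_
  have hz : z = (z.toNat : ℤ) - (-z).toNat := by omega
  have hw : w = (w.toNat : ℤ) - (-w).toNat := by omega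
  conv_rhs => rw [hz, hw]
  push_cast
  ring

theorem primrec_int_emod (m : ℤ) : Primrec fun z : ℤ => z % m := by
  rcases eq_or_ne m 0 with rfl | hm
  · exact Primrec.id.of_eq fun z => by simp
  -- Adding `|m|` before subtracting the residue of the negative part keeps everything in `ℕ`.
  have h : Primrec fun z : ℤ =>
      (((z.toNat % m.natAbs + (m.natAbs - (-z).toNat % m.natAbs)) % m.natAbs : ℕ) : ℤ)
        - (0 : ℕ) := by
    have c : ∀ a : ℕ, Primrec fun _ : ℤ => a := Primrec.const
    exact primrec_natCast_sub.comp (Primrec.nat_mod.comp (Primrec.nat_add.comp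
      (Primrec.nat_mod.comp primrec_int_toNat (c _)) (Primrec.nat_sub.comp (c _)
        (Primrec.nat_mod.comp primrec_int_neg_toNat (c _)))) (c _)) (c 0)
  refine h.of_eq fun z => ?_
  have hlt : (-z).toNat % m.natAbs < m.natAbs := Nat.mod_lt _ (Int.natAbs_pos.2 hm)
  have hz : z = (z.toNat : ℤ) - (-z).toNat := by omega
  rw [Nat.cast_zero, sub_zero, ← Int.emod_abs z m]
  push_cast [Nat.cast_sub hlt.le]
  conv_rhs => rw [hz]
  have h1 := Int.emod_add_mul_ediv (z.toNat : ℤ) |m|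
  have h2 := Int.emod_add_mul_ediv ((-z).toNat : ℤ) |m|
  rw [show ((z.toNat : ℤ) - (-z).toNat) = (z.toNat : ℤ) % |m| + (|m| - (-z).toNat % |m|)
    + |m| * ((z.toNat : ℤ) / |m| - ((-z).toNat : ℤ) / |m| - 1) by linear_combination h2 - h1]
  rw [Int.add_mul_emod_self_left]

theorem primrec_int_sum {α : Type*} [Primcodable α] : ∀ {n : ℕ} {f : Fin n → α → ℤ},
    (∀ i, Primrec (f i)) → Primrec fun a => ∑ i, f i a
  | 0, _, _ => (Primrec.const 0).of_eq fun a => by simp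
  | _ + 1, _, hf => (primrec_int_add.comp (hf 0) (primrec_int_sum fun i => hf i.succ)).of_eq
      fun a => by rw [Fin.sum_univ_succ]

theorem primrec_pi {α σ : Type*} [Primcodable α] [Primcodable σ] {n : ℕ} {f : α → Fin n → σ}
    (hf : ∀ i, Primrec fun a => f a i) : Primrec f :=
  Primrec.fin_curry.2 (Primrec.fin_curry₁ (f := fun i a => f a i) |>.2 hf |>.comp₂
    Primrec₂.right Primrec₂.left)

theorem primrec_apply {σ : Type*} [Primcodable σ] {n : ℕ} (i : Fin n) :
    Primrec fun v : Fin n → σ => v i :=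
  Primrec.fin_app.comp Primrec.id (Primrec.const i)

theorem primrec_vector_add {n : ℕ} : Primrec₂ fun v w : Fin n → ℤ => v + w :=
  primrec_pi fun i => primrec_int_add.comp ((primrec_apply i).comp Primrec.fst)
    ((primrec_apply i).comp Primrec.snd)

/-- Additive maps between free abelian groups of finite rank are primitive recursive. -/
theorem primrec_addMonoidHom {m n : ℕ} (q : (Fin m → ℤ) →+ (Fin n → ℤ)) : Primrec q := by
  refine primrec_pi fun i => ?_
  have h : ∀ j : Fin m, Primrec fun v : Fin m → ℤ => v j * q (Pi.single j 1) i := fun j =>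
    primrec_int_mul.comp (primrec_apply j) (Primrec.const _)
  refine (primrec_int_sum h).of_eq fun v => ?_
  conv_rhs => rw [pi_eq_sum_univ' v]
  simp only [map_sum, Finset.sum_apply]
  refine Finset.sum_congr rfl fun j _ => ?_
  rw [map_zsmul]
  simp

/-! ### Tilings as unique covers -/

/-- Every element of `G` is `f + a` with `f ∈ F j` and `a ∈ A j` for exactly one `(j, f, a)`. -/
def Covers {G : Type*} [AddCommGroup G] {k : ℕ} (F A : Fin k → Set G) : Prop :=
  ∀ g, ∃! t : Fin k × G × G, t.2.1 ∈ F t.1 ∧ t.2.2 ∈ A t.1 ∧ t.2.1 + t.2.2 = g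

theorem mem_tile_univ_iff {G : Type*} [AddCommGroup G] {k : ℕ} {F A : Fin k → Set G} :
    A ∈ Tile F Set.univ ↔ Covers F A := by
  constructor
  · rintro ⟨hsum, hdisj, hun⟩ g
    have hg : g ∈ ⋃ j, (F j + A j) := hun ▸ Set.mem_univ g
    obtain ⟨j, f, hf, a, ha, hfa⟩ := Set.mem_iUnion.1 hg
    refine ⟨(j, f, a), ⟨hf, ha, hfa⟩, ?_⟩
    rintro ⟨j', f', a'⟩ ⟨hf', ha', hfa'⟩
    dsimp only at hf' ha' hfa'
    obtain rfl : j' = j := by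
      by_contra hne
      exact Set.disjoint_left.1 (hdisj _ _ hne) ⟨f', hf', a', ha', hfa'⟩ ⟨f, hf, a, ha, hfa⟩
    have := ((hsum j').2 g ⟨f, hf, a, ha, hfa⟩).unique
      (y₁ := (f', a')) (y₂ := (f, a)) ⟨hf', ha', hfa'⟩ ⟨hf, ha, hfa⟩
    rw [this]
  · intro h
    refine ⟨fun j => ⟨rfl, ?_⟩, fun i j hij => ?_, ?_⟩
    · rintro _ ⟨f, hf, a, ha, rfl⟩
      refine ⟨(f, a), ⟨hf, ha, rfl⟩, ?_⟩
      rintro ⟨f', a'⟩ ⟨hf', ha', hfa'⟩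
      have := (h (f + a)).unique (y₁ := (j, f', a')) (y₂ := (j, f, a)) ⟨hf', ha', hfa'⟩
        ⟨hf, ha, rfl⟩
      simpa using this
    · rw [Set.disjoint_left]
      rintro _ ⟨f, hf, a, ha, rfl⟩ ⟨f', hf', a', ha', hfa'⟩
      have := (h (f + a)).unique (y₁ := (j, f', a')) (y₂ := (i, f, a)) ⟨hf', ha', hfa'⟩
        ⟨hf, ha, rfl⟩
      exact hij (congrArg Prod.fst this).symm
    · refine Set.eq_univ_of_forall fun g => ?_
      obtain ⟨⟨j, f, a⟩, ⟨hf, ha, hfa⟩, -⟩ := h g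
      exact Set.mem_iUnion.2 ⟨j, f, hf, a, ha, hfa⟩

theorem tile_univ_nonempty_iff {G : Type*} [AddCommGroup G] {k : ℕ} {F : Fin k → Set G} :
    (Tile F Set.univ).Nonempty ↔ ∃ A, Covers F A :=
  exists_congr fun _ => mem_tile_univ_iff

/-! ### Holes of pairwise distinct lengths -/

/-- A common lower bound for the lengths `holeLength j i`, which are less than its double. -/
def unit (k d : ℕ) : ℕ := k * d + 1

/-- The length of the `i`-th hole in the `j`-th tile. -/
def holeLength {k d : ℕ} (j : Fin k) (i : Fin d) : ℕ := unit k d + (j * d + i)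

/-- The position of the first point of the `i`-th hole. -/
def holeStart (k : ℕ) {d : ℕ} (i : Fin d) : ℕ := 4 * unit k d * i + 2 * unit k d

/-- The length of a cell. -/
def cellLength (k d : ℕ) : ℕ := 4 * unit k d * d + 2 * unit k d

/-- The index of the hole in the first cell of the `j`-th tile that contains the position `r`. -/
def hole {k : ℕ} (d : ℕ) (j : Fin k) (r : ℕ) : Option (Fin d) :=
  if h : r / (4 * unit k d) < d then
    if 2 * unit k d ≤ r % (4 * unit k d) ∧
        r % (4 * unit k d) < 2 * unit k d + holeLength j ⟨r / (4 * unit k d), h⟩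
      then some ⟨r / (4 * unit k d), h⟩ else none
  else none

section Hole

variable {k d : ℕ}

theorem unit_pos : 0 < unit k d := Nat.succ_pos _

theorem unit_le_holeLength (j : Fin k) (i : Fin d) : unit k d ≤ holeLength j i :=
  Nat.le_add_right _ _

theorem holeLength_lt (j : Fin k) (i : Fin d) : holeLength j i < 2 * unit k d := by
  have h : (j : ℕ) * d + i < k * d := by
    calc (j : ℕ) * d + i < j * d + d := by omega
      _ = (j + 1) * d := by ring
      _ ≤ k * d := Nat.mul_le_mul_right _ j.2
  unfold holeLength unit
  omega

/-- The excess `j * d + i` over `unit k d` has quotient `j` and remainder `i` modulo `d`. -/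
theorem holeLength_injective {j j' : Fin k} {i i' : Fin d}
    (h : holeLength j i = holeLength j' i') : j = j' ∧ i = i' := by
  have hd : 0 < d := i.pos
  have h' : (i : ℕ) + d * j = i' + d * j' := by
    unfold holeLength at h
    rw [mul_comm d, mul_comm d]
    omega
  constructor
  · have := congrArg (· / d) h'
    simp only [Nat.add_mul_div_left _ _ hd, Nat.div_eq_of_lt i.2, Nat.div_eq_of_lt i'.2] at this
    exact Fin.ext (by omega)
  · have := congrArg (· % d) h'
    simp only [Nat.add_mul_mod_self_left, Nat.mod_eq_of_lt i.2, Nat.mod_eq_of_lt i'.2] at this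
    exact Fin.ext this

theorem hole_add (j : Fin k) (i : Fin d) {s : ℕ} (hs : s < 4 * unit k d) :
    hole d j (4 * unit k d * i + s) =
      if 2 * unit k d ≤ s ∧ s < 2 * unit k d + holeLength j i then some i else none := by
  have h1 : (4 * unit k d * i + s) / (4 * unit k d) = i := by
    rw [Nat.mul_add_div (by omega), Nat.div_eq_of_lt hs, add_zero]
  have h2 : (4 * unit k d * i + s) % (4 * unit k d) = s := by
    rw [Nat.mul_add_mod, Nat.mod_eq_of_lt hs]
  unfold hole
  simp only [h1, h2, i.2, Fin.eta, dite_true]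

theorem hole_of_le (j : Fin k) {r : ℕ} (hr : 4 * unit k d * d ≤ r) : hole d j r = none := by
  have := unit_pos (k := k) (d := d)
  unfold hole
  rw [dif_neg]
  rw [not_lt, Nat.le_div_iff_mul_le (by omega), mul_comm]
  exact hr

theorem hole_eq_some {j : Fin k} {r : ℕ} {i : Fin d} (h : hole d j r = some i) :
    ∃ s < holeLength j i, r = holeStart k i + s := by
  unfold hole at h
  split_ifs at h with h1 h2
  have hi := Option.some.inj h
  subst hi
  have := Nat.div_add_mod r (4 * unit k d)
  refine ⟨r % (4 * unit k d) - 2 * unit k d, by omega, ?_⟩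
  unfold holeStart
  simp only
  omega

theorem hole_start_add (j : Fin k) (i : Fin d) {s : ℕ} (hs : s < holeLength j i) :
    hole d j (holeStart k i + s) = some i := by
  have := holeLength_lt j i
  unfold holeStart
  rw [add_assoc, hole_add _ _ (by omega), if_pos (by omega)]

theorem hole_start (j : Fin k) (i : Fin d) : hole d j (holeStart k i) = some i := by
  have := unit_le_holeLength j i
  have := unit_pos (k := k) (d := d)
  simpa using hole_start_add j i (s := 0) (by omega)

theorem hole_end (j : Fin k) (i : Fin d) :
    hole d j (holeStart k i + holeLength j i) = none := by
  have := holeLength_lt j i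
  unfold holeStart
  rw [add_assoc, hole_add _ _ (by omega), if_neg (by omega)]

theorem hole_of_start_le (j : Fin k) (i : Fin d) {r : ℕ} (h1 : 4 * unit k d * i ≤ r)
    (h2 : r < holeStart k i) : hole d j r = none := by
  unfold holeStart at h2
  obtain ⟨s, rfl⟩ := Nat.exists_eq_add_of_le h1
  rw [hole_add _ _ (by omega), if_neg (by omega)]

theorem holeStart_add_lt (j : Fin k) (i : Fin d) :
    holeStart k i + holeLength j i < cellLength k d := by
  have h := holeLength_lt j i
  have : 4 * unit k d * (i + 1) ≤ 4 * unit k d * d := Nat.mul_le_mul_left _ i.2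
  rw [mul_add, mul_one] at this
  unfold holeStart cellLength
  omega

/-- `r` is the first position of a maximal interval on which `hole` is constant: if this interval
is not a hole, then it is longer than all holes. -/
theorem hole_eq_none_of_first {j : Fin k} {r : ℕ} (hr : r < cellLength k d)
    (hfirst : ∀ r', r = r' + 1 → hole d j r' ≠ hole d j r) (hnone : hole d j r = none) {t : ℕ}
    (ht : t < 2 * unit k d) : r + t < cellLength k d ∧ hole d j (r + t) = none := by
  rw [hnone] at hfirst
  constructor
  · by_contra hlt
    unfold cellLength at hlt
    -- Here `r` lies in the final intact stretch, of length `2 * unit k d`, but not at its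
    -- beginning.
    obtain ⟨r', rfl⟩ : ∃ r', r = r' + 1 := ⟨r - 1, by omega⟩
    exact hfirst r' rfl (hole_of_le j (by omega))
  · by_contra hne
    obtain ⟨i, hi⟩ := Option.ne_none_iff_exists'.1 hne
    obtain ⟨s, hs, hrs⟩ := hole_eq_some hi
    rcases le_or_gt t s with hts | hts
    · have := hole_start_add j i (s := s - t) (by omega)
      rw [show holeStart k i + (s - t) = r by omega, hnone] at this
      cases this
    -- Here `r` lies among the `2 * unit k d` intact positions before hole `i`, but not at the first
    -- of them.
    · have hst : holeStart k i = 4 * unit k d * i + 2 * unit k d := rfl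
      obtain ⟨r', rfl⟩ : ∃ r', r = r' + 1 := ⟨r - 1, by omega⟩
      exact hfirst r' rfl (hole_of_start_le j i (by omega) (by omega))

theorem eq_holeStart_of_first {j : Fin k} {r : ℕ} {i : Fin d}
    (hfirst : ∀ r', r = r' + 1 → hole d j r' ≠ hole d j r) (hi : hole d j r = some i) :
    r = holeStart k i := by
  obtain ⟨s, hs, rfl⟩ := hole_eq_some hi
  cases s with
  | zero => rfl
  | succ s =>
    refine absurd ?_ (hfirst (holeStart k i + s) rfl)
    rw [hi, hole_start_add j i (by omega)]

end Hole

/-! ### Lifted tiles and their rigidity -/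

section Cell

variable {k d : ℕ} {V : Type*}

open Classical in
/-- The index of the hole at the position `r` of the cell `f` of the `j`-th tile, where only the
cell `η j` has holes. -/
noncomputable def cellHole (d : ℕ) (η : Fin k → V) (j : Fin k) (f : V) (r : ℕ) : Option (Fin d) :=
  if f = η j then hole d j r else none

theorem cellHole_self (η : Fin k → V) (j : Fin k) (r : ℕ) :
    cellHole d η j (η j) r = hole d j r := if_pos rfl

/-- A maximal interval of a cell on which `cellHole` is constant is longer than all holes, or it is
a hole. -/
theorem long_or_eq_holeStart (η : Fin k → V) {j : Fin k} {f : V} {r : ℕ} (hr : r < cellLength k d)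
    (hfirst : ∀ r', r = r' + 1 → cellHole d η j f r' ≠ cellHole d η j f r) :
    (∀ t < 2 * unit k d, r + t < cellLength k d ∧ cellHole d η j f (r + t) = none) ∨
      f = η j ∧ ∃ i : Fin d, r = holeStart k i := by
  by_cases hf : f = η j
  · subst hf
    simp only [cellHole_self] at hfirst ⊢
    cases h : hole d j r with
    | none => exact Or.inl fun t ht => hole_eq_none_of_first hr hfirst h ht
    | some i => exact Or.inr ⟨trivial, i, eq_holeStart_of_first hfirst h⟩
  · left
    simp only [cellHole, if_neg hf] at hfirst ⊢
    intro t ht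
    rw [and_true]
    -- In a cell without holes the only maximal interval is the whole cell.
    cases r with
    | zero => unfold cellLength; omega
    | succ r => exact absurd rfl (hfirst r rfl)

variable [AddCommGroup V]

/-- The point that represents the position `r` of the cell `f` of the `j`-th tile: points in the
`i`-th hole are moved to the cell `f + l i`. -/
noncomputable def cellPoint (D : V →+ V) (e : V) (l : Fin d → V) (η : Fin k → V) (j : Fin k)
    (f : V) (r : ℕ) : V :=
  D (f + (cellHole d η j f r).elim 0 l) + r • e

/-- The lift of the tile `S j`. -/
def liftTile (D : V →+ V) (e : V) (l : Fin d → V) (η : Fin k → V) (S : Fin k → Set V)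
    (j : Fin k) : Set V :=
  {v | ∃ f ∈ S j, ∃ r < cellLength k d, cellPoint D e l η j f r = v}

/-- The multiples by `D` are the first points of disjoint cells of length `n` in direction `e`
that fill the group. -/
def IsCellular (D : V →+ V) (e : V) (n : ℕ) : Prop :=
  ∀ g, ∃! p : V × ℕ, p.2 < n ∧ D p.1 + p.2 • e = g

/-- The point `g` of the group is the translate by `a ∈ A j` of the point that represents the
position `r` of the cell `f` of the `j`-th tile. -/
structure IsTag (D : V →+ V) (e : V) (l : Fin d → V) (η : Fin k → V) (S A : Fin k → Set V)
    (g : V) (j : Fin k) (f : V) (r : ℕ) (a : V) : Prop where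
  mem_tile : f ∈ S j
  lt : r < cellLength k d
  mem : a ∈ A j
  eq : cellPoint D e l η j f r + a = g

variable {Γ : Type*} [AddCommGroup Γ] {σ : V →+ Γ} {D : V →+ V} {e : V} {l : Fin d → V}
  {η : Fin k → V} {S A : Fin k → Set V}

theorem map_add_elim (hl : ∀ i, σ (l i) = 0) (o : Option (Fin d)) (f : V) :
    σ (f + o.elim 0 l) = σ f := by
  cases o <;> simp [hl]

/-- The displacements `l i` vanish under `σ`, so a point determines its position and the class of
its original cell; `S j` meets each class at most once. -/
theorem cellPoint_injective (hD : IsCellular D e (cellLength k d)) (hl : ∀ i, σ (l i) = 0)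
    (hS : ∀ j, Set.InjOn σ (S j)) {j : Fin k} {f f' : V} {r r' : ℕ} (hf : f ∈ S j)
    (hf' : f' ∈ S j) (hr : r < cellLength k d) (hr' : r' < cellLength k d)
    (h : cellPoint D e l η j f r = cellPoint D e l η j f' r') : f = f' ∧ r = r' := by
  have := (hD (cellPoint D e l η j f r)).unique (y₁ := (_, r)) (y₂ := (_, r')) ⟨hr, rfl⟩ ⟨hr', h.symm⟩
  obtain ⟨h1, h2⟩ := Prod.ext_iff.1 this
  refine ⟨hS j hf hf' ?_, h2⟩
  have := congrArg σ h1
  simpa only [map_add_elim hl] using this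

theorem IsTag.unique (hA : Covers (liftTile D e l η S) A)
    (hD : IsCellular D e (cellLength k d)) (hl : ∀ i, σ (l i) = 0)
    (hS : ∀ j, Set.InjOn σ (S j)) {g : V} {j j' : Fin k} {f f' : V} {r r' : ℕ} {a a' : V}
    (h : IsTag D e l η S A g j f r a) (h' : IsTag D e l η S A g j' f' r' a') :
    j = j' ∧ f = f' ∧ r = r' ∧ a = a' := by
  have := (hA g).unique (y₁ := (j, _, a)) (y₂ := (j', _, a'))
    ⟨⟨f, h.mem_tile, r, h.lt, rfl⟩, h.mem, h.eq⟩ ⟨⟨f', h'.mem_tile, r', h'.lt, rfl⟩, h'.mem, h'.eq⟩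
  simp only [Prod.mk.injEq] at this
  obtain ⟨rfl, h1, h2⟩ := this
  obtain ⟨h3, h4⟩ := cellPoint_injective hD hl hS h.mem_tile h'.mem_tile h.lt h'.lt h1
  exact ⟨rfl, h3, h4, h2⟩

theorem exists_isTag (hA : Covers (liftTile D e l η S) A) (g : V) :
    ∃ j f r a, IsTag D e l η S A g j f r a := by
  obtain ⟨⟨j, v, a⟩, ⟨⟨f, hf, r, hr, hv⟩, ha, hg⟩, -⟩ := hA g
  dsimp only at hf hv ha hg
  subst hv
  exact ⟨j, f, r, a, hf, hr, ha, hg⟩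

/-- Where `cellHole` is constant, all points carry the same displacement, so a step along `e` stays
in the same translate. -/
theorem IsTag.add {g : V} {j : Fin k} {f : V} {r : ℕ} {a : V}
    (h : IsTag D e l η S A g j f r a) {t : ℕ} (ht : r + t < cellLength k d)
    (hhole : cellHole d η j f (r + t) = cellHole d η j f r) :
    IsTag D e l η S A (g + t • e) j f (r + t) a := by
  refine ⟨h.mem_tile, ht, h.mem, ?_⟩
  rw [← h.eq, cellPoint, cellPoint, hhole, add_smul]
  abel

theorem IsTag.pred {g : V} {j : Fin k} {f : V} {r : ℕ} {a : V}
    (h : IsTag D e l η S A (g + e) j f (r + 1) a)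
    (hhole : cellHole d η j f r = cellHole d η j f (r + 1)) :
    IsTag D e l η S A g j f r a := by
  refine ⟨h.mem_tile, Nat.lt_of_succ_lt h.lt, h.mem, ?_⟩
  have := h.eq
  rw [cellPoint, add_smul, one_smul] at this
  rw [cellPoint, hhole, ← add_left_inj e, ← this]
  abel

/-- A translate of a maximal interval without or within a hole begins where another one ends. -/
theorem IsTag.first (hA : Covers (liftTile D e l η S) A)
    (hD : IsCellular D e (cellLength k d)) (hl : ∀ i, σ (l i) = 0)
    (hS : ∀ j, Set.InjOn σ (S j)) {g : V} {j j' : Fin k} {f f' : V} {r r' : ℕ} {a a' : V}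
    (h : IsTag D e l η S A g j f r a)
    (hne : cellHole d η j f r ≠ cellHole d η j f (r + 1))
    (h' : IsTag D e l η S A (g + e) j' f' r' a') (s : ℕ) (hs : r' = s + 1) :
    cellHole d η j' f' s ≠ cellHole d η j' f' r' := by
  subst hs
  intro heq
  obtain ⟨rfl, rfl, rfl, -⟩ := h.unique hA hD hl hS (h'.pred heq)
  exact hne heq

/-- A hole can only be filled by the points moved out of the same hole in another translate of the
same tile. -/
theorem sub_mem_of_covers (hA : Covers (liftTile D e l η S) A)
    (hD : IsCellular D e (cellLength k d)) (hl : ∀ i, σ (l i) = 0)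
    (hS : ∀ j, Set.InjOn σ (S j)) {j : Fin k} (hη : η j ∈ S j) (i : Fin d) {a : V}
    (ha : a ∈ A j) : a - D (l i) ∈ A j := by
  have hM := unit_pos (k := k) (d := d)
  set L := holeLength j i with hL
  have hL1 : unit k d ≤ L := unit_le_holeLength j i
  have hL2 : L < 2 * unit k d := holeLength_lt j i
  have hend := holeStart_add_lt j i
  obtain ⟨x, hx⟩ : ∃ x, holeStart k i = x + 1 :=
    ⟨holeStart k i - 1, by unfold holeStart; omega⟩
  have hxn : hole d j x = none :=
    hole_of_start_le j i (by unfold holeStart at hx; omega) (by omega)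
  -- The place vacated by the first point of the hole. The translate by `a` itself still covers the
  -- points just before and just after the hole.
  set y := D (η j) + holeStart k i • e + a with hy
  obtain ⟨g, hg⟩ : ∃ g, y = g + e := ⟨y - e, by abel⟩
  have before : IsTag D e l η S A g j (η j) x a := by
    refine ⟨hη, by omega, ha, ?_⟩
    rw [cellPoint, cellHole_self, hxn, Option.elim_none, add_zero, ← add_left_inj e, ← hg, hy, hx,
      add_smul, one_smul]
    abel
  have after : IsTag D e l η S A (y + L • e) j (η j) (holeStart k i + L) a := by
    refine ⟨hη, hend, ha, ?_⟩
    rw [cellPoint, cellHole_self, hole_end, Option.elim_none, add_zero, hy, add_smul]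
    abel
  obtain ⟨j', f', r', a', h'⟩ := exists_isTag hA y
  have hne : cellHole d η j (η j) x ≠ cellHole d η j (η j) (x + 1) := by
    rw [cellHole_self, cellHole_self, hxn, ← hx, hole_start]
    simp
  -- The piece covering `y` begins at `y`, since `y - e` belongs to an interval that ends there. A
  -- long piece would run over the intact point behind the hole.
  rcases long_or_eq_holeStart η h'.lt (before.first hA hD hl hS hne (hg ▸ h')) with hlong | ⟨rfl, i', rfl⟩
  · obtain ⟨hlt, hnone⟩ := hlong L hL2
    obtain ⟨-, hnone'⟩ := hlong 0 (by omega)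
    rw [add_zero] at hnone'
    obtain ⟨rfl, rfl, hr, rfl⟩ := (h'.add hlt (by rw [hnone, hnone'])).unique hA hD hl hS after
    rw [show r' = holeStart k i by omega, cellHole_self, hole_start] at hnone'
    cases hnone'
  have hlt' := holeStart_add_lt j' i'
  have add' : ∀ t < holeLength j' i', IsTag D e l η S A (y + t • e) j' (η j')
      (holeStart k i' + t) a' := fun t ht =>
    h'.add (by omega) (by rw [cellHole_self, cellHole_self, hole_start, hole_start_add _ _ ht])
  -- A longer moved piece also overruns the hole; equal lengths identify the tile and the hole.
  rcases lt_trichotomy L (holeLength j' i') with hlt | heq | hgt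
  · obtain ⟨rfl, -, hr, -⟩ := (add' L hlt).unique hA hD hl hS after
    have h1 := hole_start_add j' i' hlt
    rw [hr, hole_end] at h1
    cases h1
  · obtain ⟨rfl, rfl⟩ := holeLength_injective heq
    have := h'.eq
    rw [cellPoint, cellHole_self, hole_start, Option.elim_some, map_add, hy] at this
    have : a' = a - D (l i) := by
      rw [eq_sub_iff_add_eq]
      refine add_left_cancel (a := D (η j) + holeStart k i • e) (Eq.trans ?_ this)
      abel
    exact this ▸ h'.mem
  · set L' := holeLength j' i' with hL'
    have hL1' : unit k d ≤ L' := unit_le_holeLength j' i'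
    obtain ⟨t, ht⟩ : ∃ t, L' = t + 1 := ⟨L' - 1, by omega⟩
    obtain ⟨u, hu⟩ : ∃ u, L - L' = u + 1 := ⟨L - L' - 1, by omega⟩
    obtain ⟨j₂, f₂, r₂, a₂, h₂⟩ := exists_isTag hA (y + t • e + e)
    have hne₂ : cellHole d η j' (η j') (holeStart k i' + t) ≠
        cellHole d η j' (η j') (holeStart k i' + t + 1) := by
      rw [cellHole_self, cellHole_self, hole_start_add _ _ (by omega), add_assoc, ← ht, hole_end]
      simp
    -- A shorter piece leaves a gap of less than `unit k d` points. The next piece begins with the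
    -- gap and has at least `unit k d` points, so it overruns too.
    have const : ∀ s < unit k d, r₂ + s < cellLength k d ∧
        cellHole d η j₂ f₂ (r₂ + s) = cellHole d η j₂ f₂ r₂ := by
      intro s hs
      rcases long_or_eq_holeStart η h₂.lt ((add' t (by omega)).first hA hD hl hS hne₂ h₂) with
        hlong | ⟨rfl, i₂, rfl⟩
      · refine ⟨(hlong s (by omega)).1, ?_⟩
        rw [(hlong s (by omega)).2, ← (hlong 0 (by omega)).2, add_zero]
      · have h1 := unit_le_holeLength j₂ i₂
        have h2 := holeStart_add_lt j₂ i₂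
        refine ⟨by omega, ?_⟩
        rw [cellHole_self, cellHole_self, hole_start, hole_start_add _ _ (by omega)]
    have h₃ := h₂.add (t := L - L') (const _ (by omega)).1 (const _ (by omega)).2
    rw [show y + t • e + e + (L - L') • e = y + L • e by
      rw [show L = t + 1 + (L - L') by omega, add_smul, add_smul, one_smul,
        show t + 1 + (L - L') - L' = L - L' by omega]; abel] at h₃
    obtain ⟨rfl, rfl, hr, -⟩ := h₃.unique hA hD hl hS after
    have h4 := (const (L - L') (by omega)).2
    rw [← (const u (by omega)).2, hr, cellHole_self, cellHole_self, hole_end,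
      show r₂ + u = holeStart k i + (L - 1) by omega, hole_start_add _ _ (by omega)] at h4
    cases h4

/-- Every element of the subgroup generated by the `l i` is a difference of two elements `w` such
that subtraction of `D w` preserves `A j` for every nonempty tile `S j`. -/
theorem exists_sub_mem (hA : Covers (liftTile D e l η S) A)
    (hD : IsCellular D e (cellLength k d)) (hl : ∀ i, σ (l i) = 0)
    (hS : ∀ j, Set.InjOn σ (S j)) (hη : ∀ j, (S j).Nonempty → η j ∈ S j)
    {v : V} (hv : v ∈ AddSubgroup.closure (Set.range l)) :
    ∃ w w', w - w' = v ∧ ∀ j, (S j).Nonempty → ∀ a ∈ A j, a - D w ∈ A j ∧ a - D w' ∈ A j := by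
  induction hv using AddSubgroup.closure_induction with
  | mem v hv =>
    obtain ⟨i, rfl⟩ := hv
    exact ⟨l i, 0, by simp, fun j hj a ha =>
      ⟨sub_mem_of_covers hA hD hl hS (hη j hj) i ha, by simpa using ha⟩⟩
  | zero => exact ⟨0, 0, by simp, fun j hj a ha => by simpa using ha⟩
  | add v₁ v₂ _ _ h₁ h₂ =>
    obtain ⟨w₁, w₁', rfl, h₁⟩ := h₁
    obtain ⟨w₂, w₂', rfl, h₂⟩ := h₂
    refine ⟨w₁ + w₂, w₁' + w₂', by abel, fun j hj a ha => ?_⟩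
    rw [map_add, map_add, ← sub_sub, ← sub_sub]
    exact ⟨(h₂ j hj _ (h₁ j hj a ha).1).1, (h₂ j hj _ (h₁ j hj a ha).2).2⟩
  -- Only subtraction is known to preserve `A j`; recording differences `w - w'` lets negation be a
  -- swap.
  | neg v _ h =>
    obtain ⟨w, w', rfl, h⟩ := h
    exact ⟨w', w, by abel, fun j hj a ha => ⟨(h j hj a ha).2, (h j hj a ha).1⟩⟩

/-- The cover is read off at the first points `D u` of cells. Closure of `A j` under the
subtractions allows two representations of one element of `Γ` to be moved over the same `D u`, where
the cover is unique. -/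
theorem exists_covers_of_covers_liftTile (hσ : Function.Surjective σ)
    (hker : ∀ v, σ v = 0 ↔ v ∈ AddSubgroup.closure (Set.range l))
    (hA : Covers (liftTile D e l η S) A)
    (hD : IsCellular D e (cellLength k d)) (hS : ∀ j, Set.InjOn σ (S j))
    (hη : ∀ j, (S j).Nonempty → η j ∈ S j) :
    ∃ B, Covers (fun j => σ '' S j) B := by
  have hl : ∀ i, σ (l i) = 0 := fun i => (hker _).2 (AddSubgroup.subset_closure ⟨i, rfl⟩)
  refine ⟨fun j => {γ | ∃ b, ∃ r < cellLength k d, D b - r • e ∈ A j ∧ σ b = γ}, fun γ => ?_⟩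
  refine existsUnique_of_exists_of_unique ?_ ?_
  · obtain ⟨u, rfl⟩ := hσ γ
    obtain ⟨j, f, r, a, h⟩ := exists_isTag hA (D u)
    refine ⟨(j, σ f, σ (u - f)), ⟨f, h.mem_tile, rfl⟩,
      ⟨u - (f + (cellHole d η j f r).elim 0 l), r, h.lt, ?_, ?_⟩, by simp⟩
    · have := h.eq
      rw [cellPoint] at this
      dsimp only
      rw [map_sub D, ← this]
      convert h.mem using 1
      abel
    · rw [map_sub, map_add_elim hl, map_sub]
  · rintro ⟨j₁, _, _⟩ ⟨j₂, _, _⟩ ⟨⟨f₁, hf₁, rfl⟩, ⟨b₁, r₁, hr₁, ha₁, rfl⟩, h₁⟩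
      ⟨⟨f₂, hf₂, rfl⟩, ⟨b₂, r₂, hr₂, ha₂, rfl⟩, h₂⟩
    dsimp only at hf₁ hf₂ ha₁ ha₂ h₁ h₂
    -- The sums `f₁ + b₁` and `f₂ + b₂` differ by an element of the kernel; replacing `b₁` by `b₁ -
    -- w₁` and `b₂` by `b₂ - w₂` makes them equal.
    obtain ⟨w₁, w₂, hw, hinv⟩ := exists_sub_mem (v := f₁ + b₁ - (f₂ + b₂)) hA hD hl hS hη
      ((hker _).1 (by rw [map_sub, map_add, map_add, h₁, h₂, sub_self]))
    have key : ∀ {j f b r}, f ∈ S j → r < cellLength k d → D b - r • e ∈ A j →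
        IsTag D e l η S A (D (f + b)) j f r
          (D b - r • e - D ((cellHole d η j f r).elim 0 l)) := by
      intro j f b r hf hr ha
      refine ⟨hf, hr, ?_, ?_⟩
      -- If position `r` is in a hole, its displacement is compensated by one more subtraction.
      · cases cellHole d η j f r with
        | none => simpa using ha
        | some i => exact sub_mem_of_covers hA hD hl hS (hη j ⟨f, hf⟩) i ha
      · rw [cellPoint, map_add, map_add]
        abel
    have k₁ := key (b := b₁ - w₁) hf₁ hr₁ (by
      have := (hinv j₁ ⟨f₁, hf₁⟩ _ ha₁).1
      rw [map_sub, sub_right_comm]; exact this)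
    have k₂ := key (b := b₂ - w₂) hf₂ hr₂ (by
      have := (hinv j₂ ⟨f₂, hf₂⟩ _ ha₂).2
      rw [map_sub, sub_right_comm]; exact this)
    rw [show f₁ + (b₁ - w₁) = f₂ + (b₂ - w₂) by
      rw [sub_eq_sub_iff_add_eq_add] at hw
      rw [← add_sub_assoc, ← add_sub_assoc, sub_eq_sub_iff_add_eq_add, ← hw, add_comm]] at k₁
    obtain ⟨rfl, rfl, -, -⟩ := k₁.unique hA hD hl hS k₂
    have : σ b₁ = σ b₂ := add_left_cancel (h₁.trans h₂.symm)
    rw [this]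

/-- The full preimage of `B j` is invariant under the kernel, so the displacements inside the tiles
are absorbed by the translations. -/
theorem covers_liftTile {B : Fin k → Set Γ} (hB : Covers (fun j => σ '' S j) B)
    (hD : IsCellular D e (cellLength k d)) (hl : ∀ i, σ (l i) = 0)
    (hS : ∀ j, Set.InjOn σ (S j)) :
    Covers (liftTile D e l η S) fun j => {a | ∃ b, σ b ∈ B j ∧ D b = a} := by
  intro g
  obtain ⟨⟨u, r⟩, ⟨hr, rfl⟩, -⟩ := hD g
  dsimp only at hr ⊢
  obtain ⟨⟨j, _, β⟩, ⟨⟨f, hf, rfl⟩, hβ, hu⟩, huniq⟩ := hB (σ u)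
  dsimp only at hf hβ hu
  refine ⟨(j, cellPoint D e l η j f r, D (u - (f + (cellHole d η j f r).elim 0 l))),
    ⟨⟨f, hf, r, hr, rfl⟩, ⟨_, ?_, rfl⟩, ?_⟩, ?_⟩
  · rw [map_sub σ, map_add_elim hl, ← hu, add_sub_cancel_left]
    exact hβ
  · simp only [cellPoint, map_sub]
    abel
  · rintro ⟨j', v, a⟩ ⟨⟨f', hf', r', hr', hv⟩, ⟨b', hb', ha⟩, h⟩
    dsimp only at hf' hv hb' ha h ⊢
    subst hv ha
    have := (hD (D u + r • e)).unique
      (y₁ := (f' + (cellHole d η j' f' r').elim 0 l + b', r')) (y₂ := (u, r))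
      ⟨hr', by rw [← h, cellPoint, map_add _ _ b']; abel⟩ ⟨hr, rfl⟩
    obtain ⟨h1, rfl⟩ := Prod.ext_iff.1 this
    dsimp only at h1
    have h2 := huniq (j', σ f', σ b') ⟨⟨f', hf', rfl⟩, hb', by
      rw [← h1, map_add, map_add_elim hl]⟩
    simp only [Prod.mk.injEq] at h2
    obtain ⟨rfl, h3, -⟩ := h2
    obtain rfl := hS _ hf' hf h3
    rw [← h1, add_sub_cancel_left]

end Cell

/-! ### Coordinates on the quotient and the dilation -/

/-- A quotient of `ℤᵈ` is a product of `d` cyclic groups. -/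
theorem exists_surjective_ker_eq_dvd {d : ℕ} {Γ : Type*} [AddCommGroup Γ] (π : (Fin d → ℤ) →+ Γ)
    (hπ : Function.Surjective π) :
    ∃ (σ : (Fin d → ℤ) →+ Γ) (m : Fin d → ℤ), Function.Surjective σ ∧
      ∀ v, σ v = 0 ↔ ∀ i, m i ∣ v i := by
  classical
  obtain ⟨n, bM, bN, f, a, snf⟩ :=
    Submodule.smithNormalForm (Pi.basisFun ℤ (Fin d)) (LinearMap.ker π.toIntLinearMap)
  -- Basis vectors with no multiple in the basis of the kernel get modulus `0`: divisibility by `0`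
  -- forces that coordinate to vanish.
  refine ⟨π.comp bM.equivFun.symm.toAddEquiv.toAddMonoidHom,
    fun i => if h : ∃ s, f s = i then a h.choose else 0,
    hπ.comp bM.equivFun.symm.surjective, fun v => ?_⟩
  have hm : ∀ s, (if h : ∃ s', f s' = f s then a h.choose else 0) = a s := by
    intro s
    have h : ∃ s', f s' = f s := ⟨s, rfl⟩
    rw [dif_pos h, f.injective h.choose_spec]
  change π (bM.equivFun.symm v) = 0 ↔ _
  constructor
  · intro hv i
    have hmem : bM.equivFun.symm v ∈ LinearMap.ker π.toIntLinearMap := hv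
    have hsum := congrArg Subtype.val (bN.sum_equivFun ⟨_, hmem⟩)
    have hv' : v = bM.equivFun (∑ s, (bN.equivFun ⟨_, hmem⟩ s * a s) • bM (f s)) := by
      rw [← LinearEquiv.symm_apply_eq]
      refine hsum.symm.trans ?_
      rw [Submodule.coe_sum]
      exact Finset.sum_congr rfl fun s _ => by rw [Submodule.coe_smul, snf, mul_smul]
    rw [hv', map_sum, Finset.sum_apply]
    refine Finset.dvd_sum fun s _ => ?_
    simp only [map_smul, Module.Basis.equivFun_self, Pi.smul_apply, smul_eq_mul]
    by_cases hi : f s = i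
    · subst hi
      simp only [hm]
      exact dvd_mul_of_dvd_left (dvd_mul_left _ _) _
    · simp [hi]
  · intro hv
    rw [Module.Basis.equivFun_symm_apply, map_sum]
    refine Finset.sum_eq_zero fun i _ => ?_
    obtain ⟨c, hc⟩ := hv i
    by_cases hi : ∃ s, f s = i
    · obtain ⟨s, rfl⟩ := hi
      simp only [hm] at hc
      rw [hc, mul_comm, mul_smul, ← snf, map_zsmul]
      have : π (bN s : Fin d → ℤ) = 0 := (bN s).2
      rw [this, smul_zero]
    · simp only [dif_neg hi, zero_mul] at hc
      rw [hc, zero_smul, map_zero]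

/-- Homomorphisms from `ℤⁿ` lift along surjections. -/
theorem exists_lift_of_surjective {n : ℕ} {G H : Type*} [AddCommGroup G] [AddCommGroup H]
    (p : (Fin n → ℤ) →+ H) {σ : G →+ H} (hσ : Function.Surjective σ) :
    ∃ q : (Fin n → ℤ) →+ G, ∀ v, σ (q v) = p v := by
  choose x hx using fun i : Fin n => hσ (p (Pi.single i 1))
  refine ⟨((Pi.basisFun ℤ (Fin n)).constr ℤ x).toAddMonoidHom, fun v => ?_⟩
  have : σ.toIntLinearMap ∘ₗ (Pi.basisFun ℤ (Fin n)).constr ℤ x = p.toIntLinearMap :=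
    (Pi.basisFun ℤ (Fin n)).ext fun i => by simp [hx]
  exact LinearMap.congr_fun this v

theorem mem_closure_single_iff {d : ℕ} (m v : Fin d → ℤ) :
    v ∈ AddSubgroup.closure (Set.range fun i => Pi.single i (m i)) ↔ ∀ i, m i ∣ v i := by
  constructor
  · intro hv i
    induction hv using AddSubgroup.closure_induction with
    | mem v hv =>
      obtain ⟨j, rfl⟩ := hv
      by_cases h : i = j
      · subst h; simp
      · simp [h]
    | zero => simp
    | add v w _ _ hv hw => exact dvd_add hv hw
    | neg v _ hv => exact (dvd_neg).2 hv
  · intro hv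
    rw [← Finset.univ_sum_single v]
    refine sum_mem fun i _ => ?_
    obtain ⟨c, hc⟩ := hv i
    rw [hc, show (Pi.single i (m i * c) : Fin d → ℤ) = c • Pi.single i (m i) by
      rw [mul_comm, ← smul_eq_mul, Pi.single_smul]]
    exact zsmul_mem (AddSubgroup.subset_closure (Set.mem_range_self i)) c

/-- Multiplication of the coordinate `0` by `n`. -/
def dilation (d n : ℕ) [NeZero d] : (Fin d → ℤ) →+ (Fin d → ℤ) where
  toFun v i := if i = 0 then n * v i else v i
  map_zero' := by ext; simp
  map_add' v w := by ext i; by_cases h : i = 0 <;> simp [h, mul_add]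

theorem isCellular_dilation (d : ℕ) [NeZero d] {n : ℕ} (hn : 0 < n) :
    IsCellular (dilation d n) (Pi.single 0 1) n := by
  intro g
  have hn' : (0 : ℤ) < n := by exact_mod_cast hn
  refine ⟨(fun i => if i = 0 then g i / n else g i, (g 0 % n).toNat), ⟨?_, ?_⟩, ?_⟩
  · have := Int.emod_lt_of_pos (g 0) hn'
    have := Int.emod_nonneg (g 0) hn'.ne'
    dsimp only
    omega
  · ext i
    by_cases h : i = 0
    · subst h
      simp [dilation, Int.emod_nonneg (g 0) hn'.ne', Int.mul_ediv_add_emod]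
    · simp [dilation, h]
  · rintro ⟨u, r⟩ ⟨hr, rfl⟩
    dsimp only at hr
    have h0 : (dilation d n u + r • Pi.single 0 1 : Fin d → ℤ) 0 = r + n * u 0 := by
      simp [dilation, add_comm]
    have hr1 : ((r : ℤ) + n * u 0) % n = r := by
      rw [Int.add_mul_emod_self_left, Int.emod_eq_of_lt (by omega) (by omega)]
    refine Prod.ext ?_ ?_
    · ext i
      by_cases h : i = 0
      · subst h
        simp only [if_true, h0]
        rw [Int.add_mul_ediv_left _ _ hn'.ne', Int.ediv_eq_zero_of_lt (by omega) (by omega),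
          zero_add]
      · simp [dilation, h]
    · simp only [h0, hr1, Int.toNat_natCast]

/-- The canonical representative of `v` modulo `∏ᵢ m i ℤ`. -/
def residue {d : ℕ} (m v : Fin d → ℤ) : Fin d → ℤ := fun i => v i % m i

theorem primrec_residue {d : ℕ} (m : Fin d → ℤ) : Primrec (residue m) :=
  primrec_pi fun i => (primrec_int_emod (m i)).comp (primrec_apply i)

/-! ### The computable reduction -/

section Reduction

variable {d n k : ℕ} {Γ : Type*} [AddCommGroup Γ]

theorem map_residue {σ : (Fin d → ℤ) →+ Γ} {m : Fin d → ℤ}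
    (hσ : ∀ v, σ v = 0 ↔ ∀ i, m i ∣ v i) (v : Fin d → ℤ) : σ (residue m v) = σ v := by
  rw [← sub_eq_zero, ← map_sub, hσ]
  exact fun i => dvd_sub_comm.1 Int.dvd_self_sub_emod

/-- Different input vectors may name the same element of `Γ`; passing to residues makes `σ`
injective on the representatives. -/
theorem residue_eq {σ : (Fin d → ℤ) →+ Γ} {m : Fin d → ℤ}
    (hσ : ∀ v, σ v = 0 ↔ ∀ i, m i ∣ v i) {v w : Fin d → ℤ} (h : σ v = σ w) :
    residue m v = residue m w := by
  rw [← sub_eq_zero, ← map_sub, hσ] at h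
  exact funext fun i => Int.emod_eq_emod_iff_emod_sub_eq_zero.2 (Int.emod_eq_zero_of_dvd (h i))

/-- The canonical representatives of the elements of a tile. -/
def representatives (q : (Fin n → ℤ) →+ (Fin d → ℤ)) (m : Fin d → ℤ)
    (F : Fin k → List (Fin n → ℤ)) (j : Fin k) : List (Fin d → ℤ) :=
  (F j).map fun v => residue m (q v)

/-- The `j`-th lifted tile, as a list. -/
noncomputable def liftList [NeZero d] (q : (Fin n → ℤ) →+ (Fin d → ℤ)) (m : Fin d → ℤ)
    (F : Fin k → List (Fin n → ℤ)) (j : Fin k) : List (Fin d → ℤ) :=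
  (representatives q m F j).flatMap fun f =>
    (List.range (cellLength k d)).map
      (cellPoint (dilation d (cellLength k d)) (Pi.single 0 1) (fun i => Pi.single i (m i))
        (fun j => (representatives q m F j).headI) j f)

/-- For fixed `m` a cell has only two shapes, with and without holes. Both are constant lists, so
the algorithm only chooses one and translates it. -/
theorem primrec_liftList [NeZero d] (q : (Fin n → ℤ) →+ (Fin d → ℤ)) (m : Fin d → ℤ) :
    Primrec fun F : Fin k → List (Fin n → ℤ) => liftList q m F := by
  classical
  refine primrec_pi fun j => ?_
  set D := dilation d (cellLength k d)
  set N := cellLength k d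
  have hrep : Primrec fun F : Fin k → List (Fin n → ℤ) => representatives q m F j :=
    Primrec.list_map (primrec_apply j)
      ((primrec_residue m).comp ((primrec_addMonoidHom q).comp Primrec.snd)).to₂
  have hshape : Primrec fun x : (Fin k → List (Fin n → ℤ)) × (Fin d → ℤ) =>
      if x.2 = (representatives q m x.1 j).headI
      then (List.range N).map fun r : ℕ =>
        D ((hole d j r).elim 0 fun i => Pi.single i (m i)) + r • Pi.single 0 1
      else (List.range N).map fun r : ℕ => r • Pi.single 0 1 :=
    Primrec.ite (Primrec.eq.comp Primrec.snd
      (Primrec.list_headI.comp (hrep.comp Primrec.fst))) (Primrec.const _) (Primrec.const _)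
  refine (Primrec.list_flatMap hrep (Primrec.list_map hshape
    (primrec_vector_add.comp ((primrec_addMonoidHom D).comp (Primrec.snd.comp Primrec.fst))
      Primrec.snd).to₂).to₂).of_eq fun F => ?_
  refine List.flatMap_congr fun f _ => ?_
  by_cases hf : f = (representatives q m F j).headI
  · simp only [if_pos hf, List.map_map]
    refine List.map_congr_left fun r _ => ?_
    simp only [Function.comp, cellPoint, cellHole, if_pos hf, map_add, add_assoc]
    rfl
  · simp only [if_neg hf, List.map_map]
    refine List.map_congr_left fun r _ => ?_
    simp [cellPoint, cellHole, if_neg hf, D]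

theorem tile_liftList_nonempty_iff [NeZero d] {σ : (Fin d → ℤ) →+ Γ} {m : Fin d → ℤ}
    (hσ : Function.Surjective σ) (hm : ∀ v, σ v = 0 ↔ ∀ i, m i ∣ v i)
    {p : (Fin n → ℤ) →+ Γ} {q : (Fin n → ℤ) →+ (Fin d → ℤ)} (hq : ∀ v, σ (q v) = p v)
    (F : Fin k → List (Fin n → ℤ)) :
    (Tile (fun j => p '' {v | v ∈ F j}) (Set.univ : Set Γ)).Nonempty ↔
      (Tile (fun j => {v | v ∈ liftList q m F j}) Set.univ).Nonempty := by
  set η : Fin k → (Fin d → ℤ) := fun j => (representatives q m F j).headI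
  set S : Fin k → Set (Fin d → ℤ) := fun j => {v | v ∈ representatives q m F j}
  have hcell : 0 < cellLength k d := by
    have := unit_pos (k := k) (d := d)
    unfold cellLength
    omega
  have hD := isCellular_dilation d hcell
  have hlift : (fun j => {v | v ∈ liftList q m F j}) =
      liftTile (dilation d (cellLength k d)) (Pi.single 0 1) (fun i => Pi.single i (m i)) η S := by
    ext j v
    simp [liftList, liftTile, S, η]
  have himage : (fun j => p '' {v | v ∈ F j}) = fun j => σ '' S j := by
    ext j γ
    simp [S, representatives, map_residue hm, hq]
  have hS : ∀ j, Set.InjOn σ (S j) := by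
    intro j v hv w hw h
    obtain ⟨v, -, rfl⟩ := List.mem_map.1 hv
    obtain ⟨w, -, rfl⟩ := List.mem_map.1 hw
    rw [map_residue hm, map_residue hm] at h
    exact residue_eq hm h
  -- For an empty tile `headI` is a default value outside the tile.
  have hη : ∀ j, (S j).Nonempty → η j ∈ S j := by
    rintro j ⟨v, hv⟩
    change v ∈ representatives q m F j at hv
    change (representatives q m F j).headI ∈ representatives q m F j
    cases h : representatives q m F j with
    | nil => rw [h] at hv; cases hv
    | cons => simp
  have hker : ∀ v, σ v = 0 ↔ v ∈ AddSubgroup.closure (Set.range fun i => Pi.single i (m i)) :=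
    fun v => (hm v).trans (mem_closure_single_iff m v).symm
  rw [tile_univ_nonempty_iff, tile_univ_nonempty_iff, hlift, himage]
  constructor
  · rintro ⟨B, hB⟩
    exact ⟨_, covers_liftTile hB hD
      (fun i => (hker _).2 (AddSubgroup.subset_closure ⟨i, rfl⟩)) hS⟩
  · rintro ⟨A, hA⟩
    exact exists_covers_of_covers_liftTile hσ hker hA hD hS hη

end Reduction

theorem tile_image_nonempty_iff {G H : Type*} [AddCommGroup G] [AddCommGroup H] {k : ℕ}
    {φ : G →+ H} (hφ : Function.Bijective φ) (F : Fin k → Set G) :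
    (Tile (fun j => φ '' F j) Set.univ).Nonempty ↔ (Tile F Set.univ).Nonempty := by
  rw [tile_univ_nonempty_iff, tile_univ_nonempty_iff]
  constructor
  · rintro ⟨B, hB⟩
    refine ⟨fun j => φ ⁻¹' B j, fun g => existsUnique_of_exists_of_unique ?_ ?_⟩
    · obtain ⟨⟨j, _, b⟩, ⟨⟨f, hf, rfl⟩, hb, h⟩, -⟩ := hB (φ g)
      obtain ⟨a, rfl⟩ := hφ.2 b
      exact ⟨(j, f, a), hf, hb, hφ.1 (by rw [map_add]; exact h)⟩
    · rintro ⟨j, f, a⟩ ⟨j', f', a'⟩ ⟨hf, ha, h⟩ ⟨hf', ha', h'⟩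
      dsimp only at hf ha h hf' ha' h'
      have := (hB (φ g)).unique (y₁ := (j, φ f, φ a)) (y₂ := (j', φ f', φ a'))
        ⟨⟨f, hf, rfl⟩, ha, by rw [← h, map_add]⟩ ⟨⟨f', hf', rfl⟩, ha', by rw [← h', map_add]⟩
      simpa [hφ.1.eq_iff] using this
  · rintro ⟨A, hA⟩
    refine ⟨fun j => φ '' A j, fun g => existsUnique_of_exists_of_unique ?_ ?_⟩
    · obtain ⟨g, rfl⟩ := hφ.2 g
      obtain ⟨⟨j, f, a⟩, ⟨hf, ha, rfl⟩, -⟩ := hA g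
      exact ⟨(j, φ f, φ a), ⟨f, hf, rfl⟩, ⟨a, ha, rfl⟩, (map_add φ f a).symm⟩
    · rintro ⟨j, _, _⟩ ⟨j', _, _⟩ ⟨⟨f, hf, rfl⟩, ⟨a, ha, rfl⟩, h⟩ ⟨⟨f', hf', rfl⟩, ⟨a', ha', rfl⟩, h'⟩
      dsimp only at hf ha h hf' ha' h'
      have := (hA (f + a)).unique (y₁ := (j, f, a)) (y₂ := (j', f', a')) ⟨hf, ha, rfl⟩
        ⟨hf', ha', hφ.1 (by rw [map_add, map_add, h, h'])⟩
      simp only [Prod.mk.injEq] at this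
      obtain ⟨rfl, rfl, rfl⟩ := this
      rfl

end TranslationalTiling

open TranslationalTiling

theorem corollary3 (d : ℕ) {Γ : Type*} [AddCommGroup Γ]
    (π : (Fin d → ℤ) →+ Γ) (hπ : Function.Surjective π) (k : ℕ)
    (h : TranslationalTiling.TilingDecidable (AddMonoidHom.id (Fin d → ℤ)) k) :
    ∀ (n : ℕ) (p : (Fin n → ℤ) →+ Γ), Function.Surjective p →
      TranslationalTiling.TilingDecidable p k := by
  intro n p _
  obtain ⟨σ, m, hσ, hm⟩ := exists_surjective_ker_eq_dvd π hπ
  obtain ⟨q, hq⟩ := exists_lift_of_surjective p hσ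
  -- For `d = 0` there is no coordinate to dilate, but then `σ` is an isomorphism of trivial groups.
  rcases Nat.eq_zero_or_pos d with rfl | hd
  · refine ComputablePred.computable_of_manyOneReducible
      ⟨fun F j => (F j).map q, (primrec_pi fun j => Primrec.list_map (primrec_apply j)
        ((primrec_addMonoidHom q).comp Primrec.snd).to₂).to_comp, fun F => ?_⟩ h
    rw [← tile_image_nonempty_iff ⟨Function.injective_of_subsingleton σ, hσ⟩]
    simp only [AddMonoidHom.id_apply, List.mem_map, Set.image, Set.mem_ofPred_eq,
      exists_exists_and_eq_and, hq]
  · have : NeZero d := ⟨hd.ne'⟩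
    refine ComputablePred.computable_of_manyOneReducible
      ⟨fun F => liftList q m F, (primrec_liftList q m).to_comp, fun F => ?_⟩ h
    simpa using tile_liftList_nonempty_iff hσ hm hq F
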